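/- Signatures $\tau=\{R_1,\dots,R_m\}$ are finite and relational, with positive arities; structures are finite with nonempty domain; a graph is a structure over $\{E\}$ with $E$ binary; $\log n=\lceil\log_2 n\rceil$. A Boolean query on $\tau$ is an isomorphism-closed class of $\tau$-structures. EVEN is the query of all graphs whose domain has an even number of elements. IFP is first-order logic (with relation variables) extended by the inflationary fixed-point operator: $[\mathrm{IFP}_{\vec y,Y}\,\psi]\vec t$ says that $\vec t$ belongs to the limit of the stages $S_0=\varnothing$, $S_{n+1}=S_n\cup\{\vec b\mid \psi(\vec b,S_n)\}$. The formulas of $\exists^{\log^\omega}\mathrm{IFP}$ are $\exists^{\log^{k_1}}X_1\cdots\exists^{\log^{k_m}}X_m\,\psi$ with $m\ge 0$, all $k_i>0$, $X_i$ relation variables of nonzero arity and $\psi$ an IFP-formula, where $\mathscr A\models\exists^{\log^k}X\,\varphi$ means that $\mathscr A\models\varphi[\frac{X}{S}]$ for some $S\subseteq A^{\mathrm{arity}(X)}$ with $|S|\le(\log|A|)^k$. A language $L$ over $\{0,1,\#,\langle,\rangle\}$ is in $\beta_k$ if there are a language $L'\in\mathrm P$ and an integer $c>0$ such that for every string $u$: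 $u\in L$ iff there is $v\in\{0,1\}^*$ with $|v|\le c\cdot(\log|u|)^k$ and $u\#v\in L'$; $\beta\mathrm P=\bigcup_{k\in\mathbb N}\beta_k$. A $\beta\mathrm P$-bounded machine is a triple $(M,k,c)$ of a polynomial-time deterministic Turing machine $M$ and integers $k\ge 0$, $c>0$; it accepts $u$ iff $M$ accepts $u\#v$ for some $v\in\{0,1\}^*$ with $|v|\le c\cdot(\log|u|)^k$. Relative to a linear order of its domain, a structure is encoded by the bracketed string that lists its elements, each written with $\log|A|$ bits, and then, for each relation, the tuples in it. A Boolean query is in $\beta\mathrm P$ if some language in $\beta\mathrm P$ contains the encoding of a structure, with respect to any linear order of its domain, exactly when the structure is in the query. A logic $\mathscr L$ captures $\beta\mathrm P$ on a class $\mathcal K$ of structures if (1) for every signature $\tau$ the set of formulas $\mathscr L[\tau]$ is decidable; (2) for every $\tau$ there is a computable map that takes each $\mathscr L[\tau]$-sentence $\varphi$ to a $\beta\mathrm P$-bounded machine which, for all $\tau$-structures $\mathscr A\in\mathcal K$ and all linear orders of the domain, accepts the encoding of $\mathscr A$ iff $\mathscr A\models\varphi$; (3) for every Boolean query $\mathcal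 Q$ in $\beta\mathrm P$ there is an $\mathscr L$-sentence $\varphi$ such that for all $\mathscr A\in\mathcal K$ over the signature of $\mathcal Q$, $\mathscr A\models\varphi$ iff $\mathscr A\in\mathcal Q$. **Theorem.** EVEN is not definable in $\exists^{\log^\omega}\mathrm{IFP}$: there is no sentence $\varphi$ of $\exists^{\log^\omega}\mathrm{IFP}[\{E\}]$ such that, for every finite graph $\mathcal G$, $\mathcal G\models\varphi$ if and only if $\mathcal G\in\mathrm{EVEN}$. On the other hand, the Boolean query EVEN is in $\beta\mathrm P$. Consequently $\exists^{\log^\omega}\mathrm{IFP}$ does not capture $\beta\mathrm P$ on the class of all finite structures. -/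

import Mathlib

namespace LogIFP

/-! ### Signatures, finite structures, Boolean queries -/

/-- `log n = ⌈log₂ n⌉`. -/
def lg (n : ℕ) : ℕ := Nat.clog 2 n

/-- A finite relational signature `{R_1, …, R_m}` with positive arities. -/
structure Signature where
  size : ℕ
  arity : Fin size → ℕ+

/-- A finite `τ`-structure (with nonempty domain). -/
structure FinStr (τ : Signature) where
  carrier : Type
  [fin : Finite carrier]
  [nonempty : Nonempty carrier]
  rel : (R : Fin τ.size) → Set (Fin (τ.arity R) → carrier)

attribute [instance] FinStr.fin FinStr.nonempty

/-- Isomorphisms of `τ`-structures. -/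
structure FinStr.Iso {τ : Signature} (A B : FinStr τ) where
  toEquiv : A.carrier ≃ B.carrier
  map_rel : ∀ (R : Fin τ.size) (t : Fin (τ.arity R) → A.carrier),
    t ∈ A.rel R ↔ (toEquiv ∘ t) ∈ B.rel R

/-- A Boolean query on `τ`: a class of `τ`-structures closed under isomorphism. -/
structure BooleanQuery (τ : Signature) where
  mem : FinStr τ → Prop
  iso_closed : ∀ A B : FinStr τ, Nonempty (A.Iso B) → (mem A ↔ mem B)

/-- The signature `{E}` of graphs, with `E` binary. -/
def graphSig : Signature where
  size := 1
  arity := fun _ => 2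

/-- The query EVEN: the graphs with an even number of vertices. -/
def EVEN : BooleanQuery graphSig where
  mem := fun G => Even (Nat.card G.carrier)
  iso_closed := by
    rintro A B ⟨f⟩
    rw [Nat.card_congr f.toEquiv]

/-! ### Inflationary fixed-point logic with logarithmically bounded quantifiers -/

/-- Relation variables, with their (nonzero) arities. -/
structure RelVar where
  name : ℕ
  arity : ℕ+
deriving DecidableEq

/-- Formulas of `IFP[τ]`. Element variables are natural numbers. The formula
`[IFP_{y, Y} ψ(y, Y)] t` is `ifp Y y ψ t`, with `y` a tuple of pairwise distinct variables. -/
inductive IFP (τ : Signature) : Type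
  | eq (x y : ℕ) : IFP τ
  | rel (R : Fin τ.size) (x : Fin (τ.arity R) → ℕ) : IFP τ
  | relVar (X : RelVar) (x : Fin X.arity → ℕ) : IFP τ
  | neg (φ : IFP τ) : IFP τ
  | imp (φ ψ : IFP τ) : IFP τ
  | ex (x : ℕ) (φ : IFP τ) : IFP τ
  | ifp (Y : RelVar) (y : Fin Y.arity ↪ ℕ) (ψ : IFP τ) (t : Fin Y.arity → ℕ) : IFP τ

/-- Assignments of relations over `A` to the relation variables. -/
abbrev RelAssignment (A : Type) : Type := (X : RelVar) → Set (Fin X.arity → A)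

namespace IFP

variable {τ : Signature}

/-- Free element variables. -/
def freeVars : IFP τ → Set ℕ
  | eq x y => {x, y}
  | rel _ x => Set.range x
  | relVar _ x => Set.range x
  | neg φ => φ.freeVars
  | imp φ ψ => φ.freeVars ∪ ψ.freeVars
  | ex x φ => φ.freeVars \ {x}
  | ifp _ y ψ t => (ψ.freeVars \ Set.range y) ∪ Set.range t

/-- Free relation variables. -/
def freeRelVars : IFP τ → Set RelVar
  | eq _ _ => ∅
  | rel _ _ => ∅
  | relVar X _ => {X}
  | neg φ => φ.freeRelVars
  | imp φ ψ => φ.freeRelVars ∪ ψ.freeRelVars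
  | ex _ φ => φ.freeRelVars
  | ifp Y _ ψ _ => ψ.freeRelVars \ {Y}

/-- Truth of a formula under an assignment `ρ` of the relation variables and an assignment `a`
of the element variables. The value of `[IFP_{y, Y} ψ]` is the union of the stages
`S_0 = ∅`, `S_{n+1} = S_n ∪ {b | ψ(b, S_n)}`; on a finite domain this is the stage at which the
sequence becomes stationary. -/
def Realize (A : FinStr τ) : IFP τ → RelAssignment A.carrier → (ℕ → A.carrier) → Prop
  | eq x y, _, a => a x = a y
  | rel R x, _, a => (fun i => a (x i)) ∈ A.rel R
  | relVar X x, ρ, a => (fun i => a (x i)) ∈ ρ X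
  | neg φ, ρ, a => ¬ φ.Realize A ρ a
  | imp φ ψ, ρ, a => φ.Realize A ρ a → ψ.Realize A ρ a
  | ex x φ, ρ, a => ∃ b : A.carrier, φ.Realize A ρ (Function.update a x b)
  | ifp Y y ψ t, ρ, a =>
      ∃ n : ℕ, (fun i => a (t i)) ∈
        ((fun S : Set (Fin Y.arity → A.carrier) =>
          S ∪ {b | ψ.Realize A (Function.update ρ Y S) (Function.extend y b a)})^[n] ∅)

/-- A formula written as a string (in prefix notation) over a countable alphabet. -/
def code : IFP τ → List ℕ
  | eq x y => [0, x, y]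
  | rel R x => 1 :: (R : ℕ) :: List.ofFn x
  | relVar X x => 2 :: X.name :: (X.arity : ℕ) :: List.ofFn x
  | neg φ => 3 :: φ.code
  | imp φ ψ => 4 :: (φ.code ++ ψ.code)
  | ex x φ => 5 :: x :: φ.code
  | ifp Y y ψ t => 6 :: Y.name :: (Y.arity : ℕ) :: (List.ofFn y ++ (ψ.code ++ List.ofFn t))

end IFP

/-- Formulas of `∃^{log^ω}IFP[τ]`: `∃^{log^{k_1}} X_1 … ∃^{log^{k_m}} X_m ψ` with `m ≥ 0`,
all `k_i > 0`, and `ψ` a formula of `IFP[τ]`. -/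
inductive ExLogIFP (τ : Signature) : Type
  | base (ψ : IFP τ) : ExLogIFP τ
  | exLog (k : ℕ+) (X : RelVar) (φ : ExLogIFP τ) : ExLogIFP τ

namespace ExLogIFP

variable {τ : Signature}

/-- Free element variables. -/
def freeVars : ExLogIFP τ → Set ℕ
  | base ψ => ψ.freeVars
  | exLog _ _ φ => φ.freeVars

/-- Free relation variables. -/
def freeRelVars : ExLogIFP τ → Set RelVar
  | base ψ => ψ.freeRelVars
  | exLog _ X φ => φ.freeRelVars \ {X}

/-- Truth under an assignment; `∃^{log^k} X φ` says that some relation `S` on the domain, with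
at most `(log |A|)^k` tuples, satisfies `φ`. -/
def Realize (A : FinStr τ) : ExLogIFP τ → RelAssignment A.carrier → (ℕ → A.carrier) → Prop
  | base ψ, ρ, a => ψ.Realize A ρ a
  | exLog k X φ, ρ, a =>
      ∃ S : Set (Fin X.arity → A.carrier),
        S.ncard ≤ lg (Nat.card A.carrier) ^ (k : ℕ) ∧ φ.Realize A (Function.update ρ X S) a

/-- A formula written as a string. -/
def code : ExLogIFP τ → List ℕ
  | base ψ => ψ.code
  | exLog k X φ => 7 :: (k : ℕ) :: X.name :: (X.arity : ℕ) :: φ.code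

/-- Sentences: no free element variables and no free relation variables. -/
def IsSentence (φ : ExLogIFP τ) : Prop := φ.freeVars = ∅ ∧ φ.freeRelVars = ∅

/-- `A ⊨ φ`, for a sentence `φ` (whose truth does not depend on the assignment). -/
def Models (A : FinStr τ) (φ : ExLogIFP τ) : Prop :=
  ∀ (ρ : RelAssignment A.carrier) (a : ℕ → A.carrier), φ.Realize A ρ a

end ExLogIFP

/-! Unique readability of the string form of formulas. -/

theorem ofFn_append_inj {α : Type} {n : ℕ} {f g : Fin n → α} {s t : List α}
    (h : List.ofFn f ++ s = List.ofFn g ++ t) : f = g ∧ s = t := by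
  have h2 := List.append_inj h (by simp)
  exact ⟨List.ofFn_injective h2.1, h2.2⟩

theorem IFP.code_append_inj {τ : Signature} (φ : IFP τ) :
    ∀ (ψ : IFP τ) (s t : List ℕ), φ.code ++ s = ψ.code ++ t → φ = ψ ∧ s = t := by
  induction φ with
  | eq x y => intro ψ s t h; cases ψ <;> simp_all [IFP.code]
  | rel R x =>
    intro ψ s t h
    cases ψ with
    | rel R' x' =>
      simp only [IFP.code, List.cons_append, List.cons.injEq, true_and] at h
      obtain ⟨h1, h2⟩ := h
      obtain rfl := Fin.ext h1
      obtain ⟨rfl, rfl⟩ := ofFn_append_inj h2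
      exact ⟨rfl, rfl⟩
    | _ => simp [IFP.code] at h
  | relVar X x =>
    intro ψ s t h
    cases ψ with
    | relVar X' x' =>
      obtain ⟨n, r⟩ := X
      obtain ⟨n', r'⟩ := X'
      simp only [IFP.code, List.cons_append, List.cons.injEq, true_and] at h
      obtain ⟨rfl, h1, h2⟩ := h
      obtain rfl := PNat.eq h1
      obtain ⟨rfl, rfl⟩ := ofFn_append_inj h2
      exact ⟨rfl, rfl⟩
    | _ => simp [IFP.code] at h
  | neg φ ih =>
    intro ψ s t h
    cases ψ with
    | neg ψ =>
      simp only [IFP.code, List.cons_append, List.cons.injEq, true_and] at h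
      obtain ⟨rfl, rfl⟩ := ih _ _ _ h
      exact ⟨rfl, rfl⟩
    | _ => simp [IFP.code] at h
  | imp φ₁ φ₂ ih₁ ih₂ =>
    intro ψ s t h
    cases ψ with
    | imp ψ₁ ψ₂ =>
      simp only [IFP.code, List.cons_append, List.append_assoc, List.cons.injEq, true_and] at h
      obtain ⟨rfl, h3⟩ := ih₁ _ _ _ h
      obtain ⟨rfl, rfl⟩ := ih₂ _ _ _ h3
      exact ⟨rfl, rfl⟩
    | _ => simp [IFP.code] at h
  | ex x φ ih =>
    intro ψ s t h
    cases ψ with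
    | ex x' ψ =>
      simp only [IFP.code, List.cons_append, List.cons.injEq, true_and] at h
      obtain ⟨rfl, h⟩ := h
      obtain ⟨rfl, rfl⟩ := ih _ _ _ h
      exact ⟨rfl, rfl⟩
    | _ => simp [IFP.code] at h
  | ifp Y y φ u ih =>
    intro ψ s t h
    cases ψ with
    | ifp Y' y' ψ u' =>
      obtain ⟨n, r⟩ := Y
      obtain ⟨n', r'⟩ := Y'
      simp only [IFP.code, List.cons_append, List.append_assoc, List.cons.injEq, true_and] at h
      obtain ⟨rfl, h1, h2⟩ := h
      obtain rfl := PNat.eq h1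
      obtain ⟨hy, h⟩ := ofFn_append_inj h2
      obtain rfl := DFunLike.coe_injective hy
      obtain ⟨rfl, h4⟩ := ih _ _ _ h
      obtain ⟨rfl, rfl⟩ := ofFn_append_inj h4
      exact ⟨rfl, rfl⟩
    | _ => simp [IFP.code] at h

theorem ExLogIFP.code_injective {τ : Signature} :
    Function.Injective (ExLogIFP.code : ExLogIFP τ → List ℕ) := by
  intro φ
  induction φ with
  | base φ =>
    intro ψ h
    cases ψ with
    | base ψ =>
      have := IFP.code_append_inj φ ψ [] [] (by simpa [ExLogIFP.code] using h)
      rw [this.1]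
    | exLog k X ψ => cases φ <;> simp [ExLogIFP.code, IFP.code] at h
  | exLog k X φ ih =>
    intro ψ h
    cases ψ with
    | base ψ => cases ψ <;> simp [ExLogIFP.code, IFP.code] at h
    | exLog k' X' ψ =>
      obtain ⟨n, r⟩ := X
      obtain ⟨n', r'⟩ := X'
      simp only [ExLogIFP.code, List.cons.injEq, true_and] at h
      obtain ⟨h1, rfl, h2, h⟩ := h
      obtain rfl := PNat.eq h1
      obtain rfl := PNat.eq h2
      rw [ih h]

/-- A logic on finite structures: for every signature a set of formulas, each of which is a
string, the notion of a sentence, and the satisfaction relation. -/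
structure Logic where
  Formula : Signature → Type
  code : {τ : Signature} → Formula τ → List ℕ
  code_injective : ∀ τ : Signature, Function.Injective (code : Formula τ → List ℕ)
  IsSentence : {τ : Signature} → Formula τ → Prop
  Models : {τ : Signature} → FinStr τ → Formula τ → Prop

/-- The logic `∃^{log^ω}IFP`. -/
def exLogIFP : Logic where
  Formula := ExLogIFP
  code := ExLogIFP.code
  code_injective := fun _ => ExLogIFP.code_injective
  IsSentence := ExLogIFP.IsSentence
  Models := ExLogIFP.Models

/-- The query `Q` is defined by a sentence of `𝓛` on the class `K` of structures. -/
def Logic.DefinableOn (𝓛 : Logic) {τ : Signature} (K : Set (FinStr τ))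
    (Q : BooleanQuery τ) : Prop :=
  ∃ φ : 𝓛.Formula τ, 𝓛.IsSentence φ ∧ ∀ A ∈ K, 𝓛.Models A φ ↔ Q.mem A

/-! ### Strings, Turing machines, and the class `βP` -/

/-- The alphabet `{0, 1, #, ⟨, ⟩}`. -/
inductive Sym : Type
  | zero | one | hash | lbr | rbr
deriving DecidableEq

/-- The letter for a bit. -/
def Sym.ofBit (b : Bool) : Sym := if b then Sym.one else Sym.zero

/-- The tape symbol for a letter; tape symbols are natural numbers, and `0` is the blank. -/
def Sym.toTape : Sym → ℕ
  | zero => 1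
  | one => 2
  | hash => 3
  | lbr => 4
  | rbr => 5

/-- A deterministic one-tape Turing machine, given by its finite transition table. The entry
`((q, s), (q', s', d))` means: in state `q` reading `s`, write `s'`, move the head right if
`d = true` and left if `d = false`, and go to state `q'`. If several entries match, the first
one counts; if none does, the machine halts. The initial state is `0`, the accepting state is
`1`. -/
abbrev TM : Type := List ((ℕ × ℕ) × (ℕ × ℕ × Bool))

/-- A configuration: the state, and the tape with the position of the head. -/
abbrev TM.Cfg : Type := ℕ × Turing.Tape ℕ

namespace TM

/-- One step of computation; `none` if the machine has halted. -/
def step (M : TM) (c : Cfg) : Option Cfg :=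
  (M.lookup (c.1, c.2.head)).map fun p =>
    (p.1, (c.2.write p.2.1).move (if p.2.2 then Turing.Dir.right else Turing.Dir.left))

/-- The initial configuration on input `w`, the head on the first letter of `w`. -/
def init (w : List Sym) : Cfg := (0, Turing.Tape.mk₁ (w.map Sym.toTape))

/-- The configuration after `n` steps (a halted machine stays where it is). -/
def run (M : TM) (w : List Sym) (n : ℕ) : Cfg :=
  (fun c => (M.step c).getD c)^[n] (init w)

/-- On input `w` the machine halts after at most `n` steps. -/
def HaltsWithin (M : TM) (w : List Sym) (n : ℕ) : Prop := M.step (M.run w n) = none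

/-- The machine halts on input `w` in the accepting state. -/
def Accepts (M : TM) (w : List Sym) : Prop := ∃ n : ℕ, M.HaltsWithin w n ∧ (M.run w n).1 = 1

/-- The machine halts on every input within a number of steps polynomial in its length. -/
def PolyTime (M : TM) : Prop :=
  ∃ p : Polynomial ℕ, ∀ w : List Sym, M.HaltsWithin w (p.eval w.length)

end TM

/-- The class P of languages. -/
def P : Set (Set (List Sym)) :=
  {L | ∃ M : TM, M.PolyTime ∧ ∀ w : List Sym, w ∈ L ↔ M.Accepts w}

/-- Guess-then-check: `L ∈ GC(s, 𝒞)` if for some `L' ∈ 𝒞` and some integer `c > 0`, a string `u`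
is in `L` iff `u#v ∈ L'` for some `v ∈ {0,1}*` with `|v| ≤ c ⬝ s(|u|)`. -/
def GC (s : ℕ → ℕ) (C : Set (Set (List Sym))) : Set (Set (List Sym)) :=
  {L | ∃ L' ∈ C, ∃ c : ℕ, 0 < c ∧ ∀ u : List Sym, u ∈ L ↔
    ∃ v : List Bool, v.length ≤ c * s u.length ∧ u ++ Sym.hash :: v.map Sym.ofBit ∈ L'}

/-- `β_k = GC(log^k, P)`. -/
def beta (k : ℕ) : Set (Set (List Sym)) := GC (fun n => lg n ^ k) P

/-- `βP = ⋃_k β_k`. -/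
def betaP : Set (Set (List Sym)) := ⋃ k : ℕ, beta k

/-- A complexity class presented by machines: a type of machines (finite objects, so that
computable functions can output them), which of them obey the resource bound of the class, and
which strings they accept. -/
structure ComplexityClass where
  Machine : Type
  [primcodable : Primcodable Machine]
  Bounded : Machine → Prop
  Accepts : Machine → List Sym → Prop

attribute [instance] ComplexityClass.primcodable

/-- The languages of a complexity class. -/
def ComplexityClass.languages (C : ComplexityClass) : Set (Set (List Sym)) :=
  {L | ∃ M : C.Machine, C.Bounded M ∧ ∀ w : List Sym, w ∈ L ↔ C.Accepts M w}

/-- The complexity class `βP`. A machine `(M, k, c)` first guesses at most `c ⬝ log^k |u|` bits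
`v` on input `u`, then runs the deterministic machine `M` on `u#v`; the bound requires
that `M` runs in polynomial time and `c > 0`. -/
def BetaP : ComplexityClass where
  Machine := TM × ℕ × ℕ
  Bounded := fun N => N.1.PolyTime ∧ 0 < N.2.2
  Accepts := fun N u => ∃ v : List Bool, v.length ≤ N.2.2 * lg u.length ^ N.2.1 ∧
    N.1.Accepts (u ++ Sym.hash :: v.map Sym.ofBit)

/-- The machines of `BetaP` decide exactly the languages in `βP = ⋃_k GC(log^k, P)`. -/
theorem BetaP_languages : BetaP.languages = betaP := by
  ext L
  simp only [ComplexityClass.languages, betaP, beta, GC, P, Set.mem_ofPred_eq, Set.mem_iUnion]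
  constructor
  · rintro ⟨⟨M, k, c⟩, ⟨hM, hc⟩, hL⟩
    exact ⟨k, {w | M.Accepts w}, ⟨M, hM, fun _ => Iff.rfl⟩, c, hc, hL⟩
  · rintro ⟨k, L', ⟨M, hM, hL'⟩, c, hc, hL⟩
    refine ⟨(M, k, c), ⟨hM, hc⟩, fun u => (hL u).trans ?_⟩
    simp only [hL']
    rfl

/-! ### Encoding structures as strings -/

/-- `⟨w⟩` -/
def bracket (w : List Sym) : List Sym := Sym.lbr :: w ++ [Sym.rbr]

/-- The encoding of the `j`-th element of an `n`-element domain: the binary expression of `j`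
with `log n` bits (least significant bit first), in brackets. -/
def encElem {n : ℕ} (j : Fin n) : List Sym :=
  bracket (List.ofFn fun i : Fin (lg n) => Sym.ofBit ((j : ℕ).testBit i))

/-- All `r`-tuples over `Fin n`, in lexicographic order. -/
def tuples (n : ℕ) : (r : ℕ) → List (Fin r → Fin n)
  | 0 => [Fin.elim0]
  | r + 1 => (List.finRange n).flatMap fun a => (tuples n r).map (Fin.cons a)

/-- The encoding of a tuple. -/
def encTuple {n r : ℕ} (t : Fin r → Fin n) : List Sym :=
  bracket ((List.ofFn t).flatMap encElem)

open Classical in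
/-- The encoding of the interpretation of a relation symbol, where `a_i = e i` is the
enumeration of the domain along its linear order. -/
noncomputable def encRel {τ : Signature} (A : FinStr τ) {n : ℕ} (e : Fin n ≃ A.carrier)
    (R : Fin τ.size) : List Sym :=
  bracket (((tuples n (τ.arity R)).filter fun t => decide ((e ∘ t) ∈ A.rel R)).flatMap encTuple)

/-- The encoding of a structure whose domain is linearly ordered as `e 0 < e 1 < …`. -/
noncomputable def enc {τ : Signature} (A : FinStr τ) {n : ℕ} (e : Fin n ≃ A.carrier) :
    List Sym :=
  bracket (bracket ((List.finRange n).flatMap encElem) ++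
    (List.finRange τ.size).flatMap (encRel A e))

/-- The query `Q` is in the complexity class `C`: some language in `C` decides membership in `Q`
from the encodings of the structures, whichever linear order of the domain is used. -/
def BooleanQuery.InClass {τ : Signature} (Q : BooleanQuery τ) (C : ComplexityClass) : Prop :=
  ∃ L ∈ C.languages, ∀ (A : FinStr τ) (n : ℕ) (e : Fin n ≃ A.carrier), enc A e ∈ L ↔ Q.mem A

/-- The logic `𝓛` captures the complexity class `C` on the class `K` of structures (`K τ` being
the class of `τ`-structures in it):
1. the set of (strings that are) formulas of `𝓛[τ]` is decidable, for each `τ`;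
2. there is an effective procedure that associates with each sentence `φ` a `C`-bounded
   machine that decides on `K` whether `A ⊨ φ`;
3. each Boolean query in `C` is defined on `K` by a sentence of `𝓛`. -/
def Captures (𝓛 : Logic) (C : ComplexityClass) (K : (τ : Signature) → Set (FinStr τ)) : Prop :=
  (∀ τ : Signature, ComputablePred fun w : List ℕ => ∃ φ : 𝓛.Formula τ, 𝓛.code φ = w) ∧
  (∀ τ : Signature, ∃ f : List ℕ → C.Machine, Computable f ∧
    ∀ φ : 𝓛.Formula τ, 𝓛.IsSentence φ → C.Bounded (f (𝓛.code φ)) ∧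
      ∀ A ∈ K τ, ∀ (n : ℕ) (e : Fin n ≃ A.carrier),
        C.Accepts (f (𝓛.code φ)) (enc A e) ↔ 𝓛.Models A φ) ∧
  (∀ (τ : Signature) (Q : BooleanQuery τ), Q.InClass C → 𝓛.DefinableOn (K τ) Q)

end LogIFP

namespace LogIFP

open Filter Topology

/-! ### Formulas with few distinguished elements cannot count -/

/-! On edgeless graphs every partial injection is a partial isomorphism, so a back-and-forth
argument shows that an IFP-formula cannot tell two large domains apart, even with some elements
pinned down by a partial injection `P`. `IFP.exists_realize_iff` makes this precise: it needs only
that both domains exceed `P` by a constant depending on the formula. Fixed points are compared stage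
by stage, so the number of stages does not matter.

A witness for a log-bounded quantifier touches only polylogarithmically many elements. Given an
injection `f` from A to B, these elements are pinned to their images and the witness is transported
along `f`; it stays within the bound because `log` is monotone. Hence
(`ExLogIFP.exists_realize_of_injective`) truth passes from an edgeless A to any larger edgeless B,
once |A| beats a polynomial in log |A|. A sentence true on 2^m isolated vertices, m large, is then
true on 2^m + 1, so it does not define EVEN.

Membership of EVEN in βP needs no guessing: a one-pass automaton computes the parity of the listed
elements and halts before reaching the guess. Clause (3) of capturing therefore fails. -/

/-- A set of pairs that is the graph of a partial injection. -/
def IsPartialInj {A B : Type} (P : Set (A × B)) : Prop :=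
  ∀ p ∈ P, ∀ q ∈ P, p.1 = q.1 ↔ p.2 = q.2

theorem IsPartialInj.mono {A B : Type} {P Q : Set (A × B)} (hQ : IsPartialInj Q) (h : P ⊆ Q) :
    IsPartialInj P :=
  fun p hp q hq => hQ p (h hp) q (h hq)

/-- The pairs of values of two families at the indices in `V`. -/
def pairsOn {ι A B : Type} (V : Set ι) (a : ι → A) (b : ι → B) : Set (A × B) :=
  (fun i => (a i, b i)) '' V

/-- Two relations agree on all tuples that correspond to each other under a partial injection
that extends `P`. -/
def Compatible {A B : Type} (P : Set (A × B)) {r : ℕ} (S : Set (Fin r → A))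
    (S' : Set (Fin r → B)) : Prop :=
  ∀ t t', IsPartialInj (P ∪ pairsOn Set.univ t t') → (t ∈ S ↔ t' ∈ S')

theorem Compatible.mono {A B : Type} {P Q : Set (A × B)} {r : ℕ} {S : Set (Fin r → A)}
    {S' : Set (Fin r → B)} (h : Compatible P S S') (hPQ : P ⊆ Q) : Compatible Q S S' :=
  fun t t' ht => h t t' (ht.mono (Set.union_subset_union_left _ hPQ))

/-- The "forth" step, by pigeonhole: `P` has too few pairs to use up B, so an element outside its
range is free to be the partner of a new `c`. -/
theorem IsPartialInj.exists_right {A B : Type} [Finite B] {P : Set (A × B)}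
    (hP : IsPartialInj P) (hfin : P.Finite) (hcard : P.ncard < Nat.card B) (c : A) :
    ∃ d : B, IsPartialInj (insert (c, d) P) := by
  by_cases hc : ∃ d, (c, d) ∈ P
  · obtain ⟨d, hd⟩ := hc
    exact ⟨d, by rwa [Set.insert_eq_of_mem hd]⟩
  · have hne : Prod.snd '' P ≠ Set.univ := by
      intro h
      have := Set.ncard_image_le (f := Prod.snd) hfin
      rw [h, Set.ncard_univ] at this
      omega
    obtain ⟨d, hd⟩ := (Set.ne_univ_iff_exists_notMem _).1 hne
    refine ⟨d, ?_⟩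
    have h1 : ∀ p ∈ P, ¬ c = p.1 := fun p hp h => hc ⟨p.2, by rw [h]; exact hp⟩
    have h2 : ∀ p ∈ P, ¬ d = p.2 := fun p hp h => hd ⟨p, hp, h.symm⟩
    rintro p (rfl | hp) q (rfl | hq)
    · simp
    · simp [h1 q hq, h2 q hq]
    · simp [eq_comm, h1 p hp, h2 p hp]
    · exact hP p hp q hq

theorem IsPartialInj.swap {A B : Type} {P : Set (A × B)} (hP : IsPartialInj P) :
    IsPartialInj (Prod.swap '' P) := by
  rintro _ ⟨p, hp, rfl⟩ _ ⟨q, hq, rfl⟩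
  exact (hP p hp q hq).symm

theorem IsPartialInj.exists_left {A B : Type} [Finite A] {P : Set (A × B)}
    (hP : IsPartialInj P) (hfin : P.Finite) (hcard : P.ncard < Nat.card A) (d : B) :
    ∃ c : A, IsPartialInj (insert (c, d) P) := by
  obtain ⟨c, hc⟩ := hP.swap.exists_right (hfin.image _)
    (by rwa [Set.ncard_image_of_injective _ Prod.swap_injective]) d
  refine ⟨c, ?_⟩
  simpa [Set.image_insert_eq, Set.image_image] using hc.swap

namespace IFP

variable {τ : Signature}

theorem finite_freeVars (φ : IFP τ) : φ.freeVars.Finite := by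
  induction φ with
  | eq x y => simp [freeVars]
  | rel R x => exact Set.finite_range x
  | relVar X x => exact Set.finite_range x
  | neg φ ih => exact ih
  | imp φ ψ ih₁ ih₂ => exact ih₁.union ih₂
  | ex x φ ih => exact ih.subset Set.sdiff_subset
  | ifp Y y ψ t ih => exact (ih.subset Set.sdiff_subset).union (Set.finite_range t)

end IFP

theorem finite_pairsOn {ι A B : Type} {V : Set ι} (hV : V.Finite) (a : ι → A) (b : ι → B) :
    (pairsOn V a b).Finite :=
  hV.image _

theorem ncard_union_pairsOn_le {ι A B : Type} {V : Set ι} (hV : V.Finite) (P : Set (A × B))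
    (a : ι → A) (b : ι → B) : (P ∪ pairsOn V a b).ncard ≤ P.ncard + V.ncard :=
  (Set.ncard_union_le _ _).trans (Nat.add_le_add_left (Set.ncard_image_le hV) _)

theorem pairsOn_mono {ι A B : Type} {V W : Set ι} (h : V ⊆ W) (a : ι → A) (b : ι → B) :
    pairsOn V a b ⊆ pairsOn W a b :=
  Set.image_mono h

theorem pairsOn_update_subset {A B : Type} (V : Set ℕ) (P : Set (A × B)) (a : ℕ → A) (b : ℕ → B)
    (x : ℕ) (c : A) (d : B) :
    P ∪ pairsOn V (Function.update a x c) (Function.update b x d) ⊆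
      insert (c, d) (P ∪ pairsOn (V \ {x}) a b) := by
  rintro _ (hp | ⟨i, hi, rfl⟩)
  · exact Or.inr (Or.inl hp)
  · by_cases h : i = x
    · subst h
      simp
    · exact Or.inr (Or.inr ⟨i, ⟨hi, h⟩, by simp [h]⟩)

theorem pairsOn_extend_subset {ι A B : Type} (V : Set ℕ) (P : Set (A × B)) (a : ℕ → A)
    (b : ℕ → B) (y : ι ↪ ℕ) (t : ι → A) (t' : ι → B) :
    P ∪ pairsOn (V \ Set.range y) a b ∪ pairsOn V (Function.extend y t a) (Function.extend y t' b)
      ⊆ P ∪ pairsOn (V \ Set.range y) a b ∪ pairsOn Set.univ t t' := by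
  rintro _ (hp | ⟨i, hi, rfl⟩)
  · exact Or.inl hp
  · by_cases h : i ∈ Set.range y
    · obtain ⟨j, rfl⟩ := h
      exact Or.inr ⟨j, trivial, by simp [y.injective.extend_apply]⟩
    · exact Or.inl (Or.inr ⟨i, ⟨hi, h⟩, by
        simp only [Function.extend_apply' _ _ _ h]⟩)

/-- If the domains are large compared with the finite partial injection `P`, then an `IFP`-formula
cannot distinguish assignments that correspond to each other under an extension of `P`. -/
theorem IFP.exists_realize_iff {τ : Signature} (φ : IFP τ) :
    ∃ N : ℕ, ∀ (A B : FinStr τ), (∀ R, A.rel R = ∅) → (∀ R, B.rel R = ∅) →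
      ∀ P : Set (A.carrier × B.carrier),
      P.ncard + N ≤ Nat.card A.carrier → P.ncard + N ≤ Nat.card B.carrier →
      ∀ (ρ : RelAssignment A.carrier) (σ : RelAssignment B.carrier) (a : ℕ → A.carrier)
        (b : ℕ → B.carrier),
      (∀ X ∈ φ.freeRelVars, Compatible P (ρ X) (σ X)) →
      IsPartialInj (P ∪ pairsOn φ.freeVars a b) →
      (φ.Realize A ρ a ↔ φ.Realize B σ b) := by
  induction φ with
  | eq x y =>
    refine ⟨0, fun A B hA hB P _ _ ρ σ a b hX hP => ?_⟩
    exact hP (a x, b x) (Or.inr ⟨x, by simp [freeVars], rfl⟩)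
      (a y, b y) (Or.inr ⟨y, by simp [freeVars], rfl⟩)
  | rel R x =>
    refine ⟨0, fun A B hA hB P _ _ ρ σ a b hX hP => ?_⟩
    simp [Realize, hA, hB]
  | relVar X x =>
    refine ⟨0, fun A B hA hB P _ _ ρ σ a b hX hP => ?_⟩
    refine hX X rfl _ _ (hP.mono (Set.union_subset_union_right _ ?_))
    rintro _ ⟨i, -, rfl⟩
    exact ⟨x i, ⟨i, rfl⟩, rfl⟩
  | neg φ ih =>
    obtain ⟨N, hN⟩ := ih
    exact ⟨N, fun A B hA hB P h1 h2 ρ σ a b hX hP =>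
      not_congr (hN A B hA hB P h1 h2 ρ σ a b hX hP)⟩
  | imp φ ψ ih₁ ih₂ =>
    obtain ⟨N₁, h₁⟩ := ih₁
    obtain ⟨N₂, h₂⟩ := ih₂
    refine ⟨max N₁ N₂, fun A B hA hB P hcA hcB ρ σ a b hX hP => imp_congr ?_ ?_⟩
    · exact h₁ A B hA hB P (by omega) (by omega) ρ σ a b (fun X h => hX X (Or.inl h))
        (hP.mono (Set.union_subset_union_right _ (pairsOn_mono Set.subset_union_left _ _)))
    · exact h₂ A B hA hB P (by omega) (by omega) ρ σ a b (fun X h => hX X (Or.inr h))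
        (hP.mono (Set.union_subset_union_right _ (pairsOn_mono Set.subset_union_right _ _)))
  | ex x φ ih =>
    obtain ⟨N, hN⟩ := ih
    -- Room for the parameters, plus one element so that the extension lemmas get a strict
    -- inequality. `P` itself need not grow: the new pair enters through the assignments.
    refine ⟨N + (φ.freeVars \ {x}).ncard + 1, fun A B hA hB P hcA hcB ρ σ a b hX hP => ?_⟩
    have hV : (φ.freeVars \ {x}).Finite := φ.finite_freeVars.subset Set.sdiff_subset
    have hle := ncard_union_pairsOn_le hV P a b
    have key : ∀ c d, IsPartialInj (insert (c, d) (P ∪ pairsOn (φ.freeVars \ {x}) a b)) →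
        (φ.Realize A ρ (Function.update a x c) ↔ φ.Realize B σ (Function.update b x d)) :=
      fun c d h => hN A B hA hB P (by omega) (by omega) ρ σ _ _ hX
        (h.mono (pairsOn_update_subset _ _ _ _ _ _ _))
    constructor
    · rintro ⟨c, hc⟩
      obtain ⟨d, hd⟩ := hP.exists_right (Set.toFinite _) (show _ < _ by
        simp only [freeVars]; omega) c
      exact ⟨d, (key c d hd).1 hc⟩
    · rintro ⟨d, hd⟩
      obtain ⟨c, hc⟩ := hP.exists_left (Set.toFinite _) (show _ < _ by
        simp only [freeVars]; omega) d
      exact ⟨c, (key c d hc).2 hd⟩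
  | ifp Y y ψ t ih =>
    obtain ⟨N, hN⟩ := ih
    -- The stages depend on the values of the parameters of `ψ`, so these are added to `P` before
    -- the induction hypothesis is applied.
    refine ⟨N + (ψ.freeVars \ Set.range y).ncard, fun A B hA hB P hcA hcB ρ σ a b hX hP => ?_⟩
    have hV : (ψ.freeVars \ Set.range y).Finite := ψ.finite_freeVars.subset Set.sdiff_subset
    have hle := ncard_union_pairsOn_le hV P a b
    refine exists_congr fun n => ?_
    have stage : Compatible (P ∪ pairsOn (ψ.freeVars \ Set.range y) a b)
        ((fun S : Set (Fin Y.arity → A.carrier) =>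
          S ∪ {t | ψ.Realize A (Function.update ρ Y S) (Function.extend y t a)})^[n] ∅)
        ((fun S : Set (Fin Y.arity → B.carrier) =>
          S ∪ {t | ψ.Realize B (Function.update σ Y S) (Function.extend y t b)})^[n] ∅) := by
      induction n with
      | zero => intro u u' _; simp
      | succ n ihn =>
        intro u u' hu
        simp only [Function.iterate_succ_apply']
        refine or_congr (ihn u u' hu) (hN A B hA hB _ (by omega) (by omega) _ _ _ _ ?_
          (hu.mono (pairsOn_extend_subset _ _ _ _ _ _ _)))
        intro X hXψ
        by_cases h : X = Y
        · subst h
          simpa using ihn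
        · simpa [h] using (hX X ⟨hXψ, h⟩).mono Set.subset_union_left
    refine stage _ _ (hP.mono ?_)
    rintro _ ((hp | ⟨i, hi, rfl⟩) | ⟨i, -, rfl⟩)
    · exact Or.inl hp
    · exact Or.inr ⟨i, Or.inl hi, rfl⟩
    · exact Or.inr ⟨t i, Or.inr ⟨i, rfl⟩, rfl⟩

/-! ### Transporting logarithmically bounded witnesses -/

/-- The elements that occur in a tuple of `S`. -/
def support {A : Type} {r : ℕ} (S : Set (Fin r → A)) : Set A :=
  ⋃ i : Fin r, (fun t => t i) '' S

theorem ncard_support_le {A : Type} [Finite A] {r : ℕ} (S : Set (Fin r → A)) :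
    (support S).ncard ≤ r * S.ncard := by
  refine (Set.ncard_iUnion_le_of_fintype _).trans ?_
  refine (Finset.sum_le_card_nsmul _ _ S.ncard fun i _ => ?_).trans (by simp)
  exact Set.ncard_image_le (Set.toFinite _)

/-- Once each element of the support is paired with its image, a partial injection extending `P`
leaves it no other partner. A tuple of `S` can thus correspond only to its image, and an image tuple
only to its original. -/
theorem compatible_image {A B : Type} (f : A → B) {r : ℕ} (S : Set (Fin r → A))
    {P : Set (A × B)} (hP : ∀ x ∈ support S, (x, f x) ∈ P) :
    Compatible P S ((fun t => f ∘ t) '' S) := by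
  intro t t' h
  have hs : ∀ s ∈ S, ∀ i, (s i, f (s i)) ∈ P := fun s hs i =>
    hP _ (Set.mem_iUnion.2 ⟨i, s, hs, rfl⟩)
  constructor
  · intro ht
    refine ⟨t, ht, funext fun i => ?_⟩
    exact (h _ (Or.inl (hs t ht i)) (t i, t' i) (Or.inr ⟨i, trivial, rfl⟩)).1 rfl
  · rintro ⟨s, hsS, rfl⟩
    have : t = s := funext fun i =>
      (h (t i, f (s i)) (Or.inr ⟨i, trivial, rfl⟩) _ (Or.inl (hs s hsS i))).2 rfl
    rwa [this]

/-- A formula of `∃^{log^ω}IFP` without free element variables is preserved when a large edgeless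
structure is enlarged. The function `T` bounds the number of elements that are distinguished. -/
theorem ExLogIFP.exists_realize_of_injective {τ : Signature} (φ : ExLogIFP τ) :
    ∃ T : ℕ → ℕ, Tendsto (fun m => (T m : ℝ) / 2 ^ m) atTop (𝓝 0) ∧
      ∀ (A B : FinStr τ), (∀ R, A.rel R = ∅) → (∀ R, B.rel R = ∅) →
      ∀ f : A.carrier → B.carrier, Function.Injective f →
      ∀ P : Set (A.carrier × B.carrier), (∀ p ∈ P, p.2 = f p.1) →
      P.ncard + T (lg (Nat.card A.carrier)) ≤ Nat.card A.carrier →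
      ∀ (ρ : RelAssignment A.carrier) (σ : RelAssignment B.carrier) (a : ℕ → A.carrier)
        (b : ℕ → B.carrier),
      (∀ X ∈ φ.freeRelVars, Compatible P (ρ X) (σ X)) → φ.freeVars = ∅ →
      φ.Realize A ρ a → φ.Realize B σ b := by
  induction φ with
  | base ψ =>
    obtain ⟨N, hN⟩ := ψ.exists_realize_iff
    refine ⟨fun _ => N, ?_, fun A B hA hB f hf P hP hc ρ σ a b hX hV h => ?_⟩
    · exact tendsto_const_nhds.div_atTop (tendsto_pow_atTop_atTop_of_one_lt one_lt_two)
    · have hAB := Nat.card_le_card_of_injective f hf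
      have hV' : ψ.freeVars = ∅ := hV
      dsimp only at hc
      refine (hN A B hA hB P hc (by omega) ρ σ a b hX ?_).1 h
      -- `P` lies in the graph of the injective `f`, and without free variables nothing else is
      -- added.
      rintro p (hp | ⟨i, hi, -⟩) q (hq | ⟨j, hj, -⟩)
      · rw [hP p hp, hP q hq, hf.eq_iff]
      all_goals simp_all
  | exLog k X φ ih =>
    obtain ⟨T, hT, ih⟩ := ih
    -- The new summand bounds the support of the witness; polynomial in `m`, it vanishes against
    -- 2^m.
    refine ⟨fun m => X.arity * m ^ (k : ℕ) + T m, ?_,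
      fun A B hA hB f hf P hP hc ρ σ a b hX hV => ?_⟩
    · have h := (tendsto_pow_const_div_const_pow_of_one_lt (k : ℕ) (one_lt_two (α := ℝ))).const_mul
        ((X.arity : ℕ) : ℝ)
      simpa [add_div, mul_div_assoc] using h.add hT
    · rintro ⟨S, hS, h⟩
      dsimp only at hc
      have hAB := Nat.card_le_card_of_injective f hf
      refine ⟨(fun t => f ∘ t) '' S, ?_, ?_⟩
      · refine (Set.ncard_image_le (Set.toFinite _)).trans (hS.trans ?_)
        exact Nat.pow_le_pow_left (Nat.clog_mono_right 2 hAB) _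
      · have hcard : (P ∪ pairsOn (support S) id f).ncard ≤
            P.ncard + X.arity * lg (Nat.card A.carrier) ^ (k : ℕ) :=
          (ncard_union_pairsOn_le (Set.toFinite _) _ _ _).trans (Nat.add_le_add_left
            ((ncard_support_le S).trans (Nat.mul_le_mul_left _ hS)) _)
        refine ih A B hA hB f hf (P ∪ pairsOn (support S) id f) ?_ (by omega) _ _ a b ?_ hV h
        · rintro p (hp | ⟨x, -, rfl⟩)
          · exact hP p hp
          · rfl
        · intro Z hZ
          by_cases hZX : Z = X
          · subst hZX
            simpa using compatible_image f S (fun x hx => Or.inr ⟨x, hx, rfl⟩)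
          · simpa [hZX] using (hX Z ⟨hZ, hZX⟩).mono Set.subset_union_left

/-- The edgeless graph with `n + 1` vertices. -/
def edgeless (n : ℕ) : FinStr graphSig where
  carrier := Fin (n + 1)
  rel := fun _ => ∅

theorem EVEN_not_definable : ¬ exLogIFP.DefinableOn Set.univ EVEN := by
  rintro ⟨φ, ⟨hV, hR⟩, h⟩
  change ExLogIFP graphSig at φ
  change φ.freeVars = ∅ at hV
  change φ.freeRelVars = ∅ at hR
  obtain ⟨T, hT, hφ⟩ := φ.exists_realize_of_injective
  -- `m ≥ 1` makes 2^m even; a power of two makes the logarithm exactly `m`.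
  obtain ⟨m, hm, hm1⟩ := ((hT.eventually_lt_const one_pos).and (eventually_ge_atTop 1)).exists
  rw [div_lt_one (by positivity)] at hm
  have hm' : T m < 2 ^ m := by exact_mod_cast hm
  obtain ⟨n, hn⟩ : ∃ n, 2 ^ m = n + 1 := ⟨2 ^ m - 1, by omega⟩
  have hA : Nat.card (edgeless n).carrier = 2 ^ m := by simp [edgeless, hn]
  have hB : Nat.card (edgeless (n + 1)).carrier = 2 ^ m + 1 := by simp [edgeless, hn]
  have heven : Even (2 ^ m) := (Nat.even_pow.2 ⟨even_two, by omega⟩)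
  have h1 : φ.Models (edgeless n) := (h _ trivial).2 (by change Even _; rwa [hA])
  have h2 : φ.Models (edgeless (n + 1)) := by
    intro σ b
    refine hφ (edgeless n) (edgeless (n + 1)) (fun _ => rfl) (fun _ => rfl) Fin.castSucc
      (Fin.castSucc_injective _) ∅ (by simp) ?_ (fun _ => ∅) σ (fun _ => (0 : Fin (n + 1))) b
      (by simp [hR]) hV (h1 _ _)
    rw [hA, lg, Nat.clog_pow 2 m one_lt_two]
    simpa using hm'.le
  have h3 : Even (Nat.card (edgeless (n + 1)).carrier) := (h _ trivial).1 h2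
  rw [hB] at h3
  exact Nat.not_even_iff_odd.2 heven.add_one h3

/-! ### A Turing machine for EVEN -/

/-- A machine that scans the list of elements of an encoded structure from left to right. It is
in state `3` (resp. `5`) after an even (resp. odd) number of elements. -/
def evenTM : TM :=
  [((0, 4), (2, 4, true)), ((2, 4), (3, 4, true)),
   ((3, 4), (4, 4, true)), ((4, 1), (4, 1, true)), ((4, 2), (4, 2, true)), ((4, 5), (5, 5, true)),
   ((5, 4), (6, 4, true)), ((6, 1), (6, 1, true)), ((6, 2), (6, 2, true)), ((6, 5), (3, 5, true)),
   ((3, 5), (1, 5, true))]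

/-- The configuration in state `q` with the word `w` from the head on and `l` to the left. -/
def scanCfg (q : ℕ) (l : Turing.ListBlank ℕ) (w : List Sym) : TM.Cfg :=
  (q, Turing.Tape.mk' l (Turing.ListBlank.mk (w.map Sym.toTape)))

theorem step_scanCfg_cons (q : ℕ) (l : Turing.ListBlank ℕ) (s : Sym) (w : List Sym) :
    evenTM.step (scanCfg q l (s :: w)) =
      (evenTM.lookup (q, s.toTape)).map fun p =>
        (p.1, ((Turing.Tape.mk' l (Turing.ListBlank.mk ((s :: w).map Sym.toTape))).write p.2.1).move
          (if p.2.2 then Turing.Dir.right else Turing.Dir.left)) := by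
  simp [TM.step, scanCfg]

theorem move_write (l : Turing.ListBlank ℕ) (s : Sym) (w : List Sym) :
    ((Turing.Tape.mk' l (Turing.ListBlank.mk ((s :: w).map Sym.toTape))).write s.toTape).move
      Turing.Dir.right =
    Turing.Tape.mk' (l.cons s.toTape) (Turing.ListBlank.mk (w.map Sym.toTape)) := by
  simp [← Turing.ListBlank.cons_mk]

/-- The next state of the machine, `none` if it halts. -/
def nextState (q : ℕ) (s : Sym) : Option ℕ := (evenTM.lookup (q, s.toTape)).map Prod.fst

theorem mem_of_lookup_eq_some {α β : Type*} [BEq α] [LawfulBEq α] {l : List (α × β)}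
    {a : α} {b : β} (h : l.lookup a = some b) : (a, b) ∈ l := by
  obtain ⟨l₁, l₂, rfl, -⟩ := List.lookup_eq_some_iff.1 h
  simp

/-- The machine is a finite automaton: it never changes the tape, moves only right, and halts on the
blank. -/
theorem eq_of_mem_evenTM {x : ℕ × ℕ} {y : ℕ × ℕ × Bool} (h : (x, y) ∈ evenTM) :
    y.2 = (x.2, true) ∧ x.2 ≠ 0 := by
  simp only [evenTM, List.mem_cons, Prod.mk.injEq, List.not_mem_nil, or_false] at h
  rcases h with h | h | h | h | h | h | h | h | h | h | h <;>
    (obtain ⟨rfl, rfl⟩ := h; simp)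

theorem step_scanCfg (q : ℕ) (l : Turing.ListBlank ℕ) (s : Sym) (w : List Sym) :
    evenTM.step (scanCfg q l (s :: w)) =
      (nextState q s).map fun q' => scanCfg q' (l.cons s.toTape) w := by
  rw [step_scanCfg_cons, nextState]
  cases h : evenTM.lookup (q, s.toTape) with
  | none => rfl
  | some p =>
    have hp := (eq_of_mem_evenTM (mem_of_lookup_eq_some h)).1
    obtain ⟨q', s', d⟩ := p
    obtain ⟨rfl, rfl⟩ := Prod.mk.inj hp
    simp only [Option.map_some, if_true, scanCfg]
    rw [move_write]

theorem step_scanCfg_nil (q : ℕ) (l : Turing.ListBlank ℕ) :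
    evenTM.step (scanCfg q l []) = none := by
  have : evenTM.lookup (q, 0) = none := by
    cases h : evenTM.lookup (q, 0) with
    | none => rfl
    | some p => exact absurd rfl (eq_of_mem_evenTM (mem_of_lookup_eq_some h)).2
  have h0 : (scanCfg q l []).2.head = 0 := by simp [scanCfg]
  rw [TM.step, h0]
  simp only [scanCfg] at this ⊢
  rw [this]; rfl

/-- The state in which the machine, started in state `q` on the word `w`, halts. -/
def finalState : ℕ → List Sym → ℕ
  | q, [] => q
  | q, s :: w => match nextState q s with
    | none => q
    | some q' => finalState q' w

/-- Each step consumes one letter, so the length of the word bounds the running time; the tape to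
the left is irrelevant and is generalized for the induction. -/
theorem iterate_step_scanCfg (w : List Sym) : ∀ (q : ℕ) (l : Turing.ListBlank ℕ) (n : ℕ),
    w.length ≤ n →
    evenTM.step ((fun c => (evenTM.step c).getD c)^[n] (scanCfg q l w)) = none ∧
    ((fun c => (evenTM.step c).getD c)^[n] (scanCfg q l w)).1 = finalState q w := by
  have halt : ∀ (c : TM.Cfg) (n : ℕ), evenTM.step c = none →
      (fun c => (evenTM.step c).getD c)^[n] c = c := fun c n h =>
    Function.iterate_fixed (by simp [h]) n
  induction w with
  | nil =>
    intro q l n _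
    rw [halt _ _ (step_scanCfg_nil q l)]
    exact ⟨step_scanCfg_nil q l, rfl⟩
  | cons s w ih =>
    intro q l n hn
    have hs := step_scanCfg q l s w
    cases h : nextState q s with
    | none =>
      rw [h] at hs
      rw [halt _ _ hs]
      exact ⟨hs, by simp [finalState, h, scanCfg]⟩
    | some q' =>
      rw [h] at hs
      obtain ⟨n, rfl⟩ : ∃ k, n = k + 1 := ⟨n - 1, by simp at hn; omega⟩
      simp only [Function.iterate_succ_apply, hs, Option.map_some, Option.getD_some, finalState, h]
      exact ih q' _ n (by simpa using hn)

theorem polyTime_evenTM : evenTM.PolyTime :=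
  ⟨Polynomial.X, fun w => by
    rw [Polynomial.eval_X]
    exact (iterate_step_scanCfg w 0 _ _ le_rfl).1⟩

theorem accepts_evenTM_iff (w : List Sym) : evenTM.Accepts w ↔ finalState 0 w = 1 := by
  have main := fun n => iterate_step_scanCfg w 0 (Turing.ListBlank.mk []) n
  constructor
  · rintro ⟨n, h1, h2⟩
    rcases le_total w.length n with h | h
    · rw [← (main n h).2]
      exact h2
    -- A machine that halted early stays put until step `w.length`.
    · have hrun : evenTM.run w w.length = evenTM.run w n := by
        obtain ⟨k, hk⟩ := Nat.exists_eq_add_of_le' h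
        unfold TM.run
        rw [hk, Function.iterate_add_apply]
        refine Function.iterate_fixed ?_ k
        have : evenTM.step (evenTM.run w n) = none := h1
        simp only [TM.run] at this
        simp [this]
      rw [← (main w.length le_rfl).2]
      change (evenTM.run w w.length).1 = 1
      rw [hrun]
      exact h2
  · intro h
    exact ⟨w.length, (main _ le_rfl).1, (main _ le_rfl).2.trans h⟩

theorem finalState_bits (q : ℕ) (hq : q = 4 ∨ q = 6) (v : List Bool) (w : List Sym) :
    finalState q (v.map Sym.ofBit ++ w) = finalState q w := by
  induction v with
  | nil => rfl
  | cons b v ih =>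
    have : nextState q (Sym.ofBit b) = some q := by
      rcases hq with rfl | rfl <;> cases b <;> rfl
    simp [finalState, this, ih]

theorem finalState_encElem {n : ℕ} (j : Fin n) (w : List Sym) :
    finalState 3 (encElem j ++ w) = finalState 5 w ∧
    finalState 5 (encElem j ++ w) = finalState 3 w := by
  have h : (List.ofFn fun i : Fin (lg n) => Sym.ofBit ((j : ℕ).testBit i)) =
      (List.ofFn fun i : Fin (lg n) => (j : ℕ).testBit i).map Sym.ofBit := by
    simp [List.map_ofFn, Function.comp_def]
  simp only [encElem, bracket, h, List.cons_append, List.append_assoc]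
  constructor
  · change finalState 4 _ = _
    rw [finalState_bits 4 (Or.inl rfl)]
    rfl
  · change finalState 6 _ = _
    rw [finalState_bits 6 (Or.inr rfl)]
    rfl

/-- Each element swaps states 3 and 5. The bracket closing the list sends 3 to the accepting state,
which has no transitions, and stops the machine in 5; hence `w` is never examined. -/
theorem finalState_elems {n : ℕ} (l : List (Fin n)) (w : List Sym) :
    (finalState 3 (l.flatMap encElem ++ Sym.rbr :: w) = 1 ↔ Even l.length) ∧
    (finalState 5 (l.flatMap encElem ++ Sym.rbr :: w) = 1 ↔ ¬ Even l.length) := by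
  induction l with
  | nil =>
    have h3 : finalState 3 (Sym.rbr :: w) = 1 := by
      change finalState 1 w = 1
      cases w with
      | nil => rfl
      | cons s w => cases s <;> rfl
    have h5 : finalState 5 (Sym.rbr :: w) = 5 := rfl
    simp [h3, h5]
  | cons j l ih =>
    simp only [List.flatMap_cons, List.append_assoc, finalState_encElem, ih, List.length_cons,
      Nat.even_add_one, not_not, and_self]

theorem EVEN_inClass : EVEN.InClass BetaP := by
  -- Exponent 0 and factor 1 allow at most one guessed bit, which has no effect on the verdict.
  refine ⟨{w | BetaP.Accepts (evenTM, 0, 1) w},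
    ⟨(evenTM, 0, 1), ⟨polyTime_evenTM, one_pos⟩, fun _ => Iff.rfl⟩, fun A n e => ?_⟩
  have key : ∀ w : List Sym, evenTM.Accepts (enc A e ++ w) ↔ EVEN.mem A := by
    intro w
    rw [accepts_evenTM_iff]
    simp only [enc, bracket, List.cons_append, List.append_assoc]
    -- The two opening brackets take state 0 through 2 to 3 by computation.
    refine (finalState_elems (List.finRange n) _).1.trans ?_
    have hn : Nat.card A.carrier = n := by simp [← Nat.card_congr e]
    change Even _ ↔ Even _
    rw [hn, List.length_finRange]
  exact ⟨fun ⟨v, _, hv⟩ => (key _).1 hv, fun h => ⟨[], by simp, (key _).2 h⟩⟩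

end LogIFP

theorem mainTheorem5 :
    (¬ LogIFP.exLogIFP.DefinableOn Set.univ LogIFP.EVEN) ∧
    LogIFP.EVEN.InClass LogIFP.BetaP ∧
    ¬ LogIFP.Captures LogIFP.exLogIFP LogIFP.BetaP (fun _ => Set.univ) :=
  ⟨LogIFP.EVEN_not_definable, LogIFP.EVEN_inClass,
    fun h => LogIFP.EVEN_not_definable (h.2.2 _ _ LogIFP.EVEN_inClass)⟩
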